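/- Let $\mathsf B$ be a locally presentable abelian category which has a projective generator (that is, a projective object $P$ such that the functor $\operatorname{Hom}_{\mathsf B}(P,-)$ is faithful). Let $\mathsf K(\mathsf B)$ be the homotopy category of unbounded complexes in $\mathsf B$, and let $\mathsf D(\mathsf B)$ be the unbounded derived category, i.e. the Verdier quotient of $\mathsf K(\mathsf B)$ by the full subcategory of acyclic complexes. Let $\mathsf K(\mathsf B_{\mathsf{proj}})_{\mathsf{hpr}}\subset\mathsf K(\mathsf B)$ be the full triangulated subcategory of \emph{homotopy projective complexes of projective objects}, i.e. of those complexes $P^\bullet$ such that every term $P^n$ ($n\in\mathbb Z$) is a projective object of $\mathsf B$ and $\operatorname{Hom}_{\mathsf K(\mathsf B)}(P^\bullet,X^\bullet)=0$ for every acyclic complex $X^\bullet$ in $\mathsf B$. Then $\mathsf B$ has enough homotopy projective complexes of projective objects; in other words, the natural functor $$\mathsf K(\mathsf B_{\mathsf{proj}})_{\mathsf{hpr}}\longrightarrow\mathsf D(\mathsf B),$$ the composition of the inclusion into $\mathsf K(\mathsf B)$ with the Verdier quotient functor $\mathsf K(\mathsf B)\to\mathsf D(\mathsf B)$, is a triangulated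 equivalence. -/

import Mathlib

open CategoryTheory Limits Pretriangulated ZeroObject

universe w v u

namespace HomotopyCategory

variable (B : Type u) [Category.{v} B] [Abelian B]

/-- The homotopy projective complexes: the objects `P` of the homotopy category `K(B)` of
(unbounded) complexes such that every morphism `P ⟶ X` in `K(B)` to an acyclic complex `X`
is zero. -/
abbrev homotopyProjective : ObjectProperty (HomotopyCategory B (ComplexShape.up ℤ)) :=
  (subcategoryAcyclic B).leftOrthogonal

/-- The complexes all of whose terms are projective objects of `B`. -/
def projectiveTerms : ObjectProperty (HomotopyCategory B (ComplexShape.up ℤ)) :=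
  fun K ↦ ∀ n : ℤ, Projective (K.as.X n)

/-- The homotopy projective complexes of projective objects. -/
abbrev homotopyProjectiveOfProjectives :
    ObjectProperty (HomotopyCategory B (ComplexShape.up ℤ)) :=
  homotopyProjective B ⊓ projectiveTerms B

instance : (projectiveTerms B).ContainsZero where
  exists_zero := ⟨(quotient B (ComplexShape.up ℤ)).obj (0 : CochainComplex B ℤ),
    Functor.map_isZero _ (isZero_zero _), fun n ↦
      ((HomologicalComplex.eval B (ComplexShape.up ℤ) n).map_isZero (isZero_zero _)).projective⟩

instance : (projectiveTerms B).IsStableUnderShift ℤ where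
  isStableUnderShiftBy n :=
    { le_shift := fun K hK i ↦ by
        obtain ⟨K, rfl⟩ := K.quotient_obj_surjective
        have h : Projective (K.X (i + n)) := hK (i + n)
        rw [shift_quotient_obj]
        exact h }

instance : (projectiveTerms B).IsTriangulatedClosed₃ where
  ext₃' T hT h₁ h₂ := by
    obtain ⟨f : T.obj₁.as ⟶ T.obj₂.as, hf⟩ := (quotient _ _).map_surjective T.mor₁
    have h : projectiveTerms B ((quotient B _).obj (CochainComplex.mappingCone f)) := fun n ↦ by
      have h₁' : Projective (T.obj₁.as.X (n + 1)) := h₁ _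
      have h₂' : Projective (T.obj₂.as.X n) := h₂ _
      exact Projective.of_iso
        (HomologicalComplex.homotopyCofiber.XIsoBiprod f n (n + 1) rfl).symm inferInstance
    refine ⟨_, h,
      ⟨Triangle.π₃.mapIso (isoTriangleOfIso₁₂ T _ hT (mappingCone_triangleh_distinguished f)
        (Iso.refl _) (Iso.refl _) ?_)⟩⟩
    exact (Category.comp_id _).trans (hf.symm.trans (Category.id_comp _).symm)

instance : (projectiveTerms B).IsTriangulated where
  toIsTriangulatedClosed₂ := .of_isTriangulatedClosed₃

/-- `K(B_proj)_hpr`: the full (triangulated) subcategory of `K(B)` of homotopy projective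
complexes of projective objects. -/
abbrev KProjHpr := (homotopyProjectiveOfProjectives B).FullSubcategory

/-- The natural functor `K(B_proj)_hpr ⥤ D(B)`: the inclusion into the homotopy category `K(B)`
followed by the localization functor to the derived category. -/
noncomputable abbrev KProjHpr.toDerivedCategory [HasDerivedCategory.{w} B] :
    KProjHpr B ⥤ DerivedCategory B :=
  (homotopyProjectiveOfProjectives B).ι ⋙ DerivedCategory.Qh

/-- The abelian category `B` has enough homotopy projective complexes of projective objects:
the natural functor `K(B_proj)_hpr ⥤ D(B)` is a triangulated equivalence. -/
structure HasEnoughHomotopyProjectivesOfProjectives [HasDerivedCategory.{w} B] : Prop where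
  isTriangulated : (KProjHpr.toDerivedCategory.{w} B).IsTriangulated
  isEquivalence : (KProjHpr.toDerivedCategory.{w} B).IsEquivalence

end HomotopyCategory

/-!
Every complex `K` admits a quasi-isomorphism `L ⟶ K` from a K-projective complex `L` with
projective terms; it is obtained by the small object argument in the category of complexes.

Let `P` be a projective separator. The generating maps are the inclusions of the complex `P`
concentrated in degree `i + 1` into the contractible complex `P = P` in degrees `i` and `i + 1`
(`CochainComplex.sphereToDisk`). As every object of a locally presentable category is presentable
and the source of a generating map is the cokernel of a map between disks, the small object
argument applies, and it factors `0 ⟶ K` as `0 ⟶ L ⟶ K`, where `L ⟶ K` has the right lifting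
property with respect to the generating maps and `0 ⟶ L` has the left lifting property with
respect to all such maps.

The lifting property of `L ⟶ K` says that maps from `P` see it as a surjective quasi-isomorphism,
so that it is a quasi-isomorphism (`CochainComplex.quasiIso_of_rlp_sphereToDisks`). In the other
direction, a termwise epimorphism between acyclic complexes has the right lifting property
(`CochainComplex.rlp_sphereToDisks_of_acyclic`), hence maps out of `L` lift along it. Applied to
the map of cones of identities induced by an epimorphism `M ⟶ N` in degree `n`, this shows that
`L.X n` is projective; applied to the map from the cocone of `𝟙 A` to an acyclic complex `A`, it
shows that any map `L ⟶ A` factors through a contractible complex. No exactness of coproducts or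
of filtered colimits is involved.

Finally, the functor to the derived category is fully faithful because morphisms out of a left
orthogonal object to the acyclic complexes are the same in the homotopy category and in the
Verdier quotient, and it is essentially surjective because of the resolutions above.
-/

namespace CochainComplex

open HomologicalComplex Opposite

variable {B : Type u} [Category.{v} B] [Abelian B]

/-! ### Spheres and disks -/

/-- The contractible complex `P = P` in degrees `i` and `i + 1`. -/
noncomputable abbrev disk (P : B) (i : ℤ) : CochainComplex B ℤ :=
  double (𝟙 P) (show (ComplexShape.up ℤ).Rel i (i + 1) from rfl)

/-- The complex consisting of `P` in degree `i`. -/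
noncomputable abbrev sphere (P : B) (i : ℤ) : CochainComplex B ℤ :=
  (single B (ComplexShape.up ℤ) i).obj P

/-- The inclusion of `P` in degree `i + 1` into the disk in degrees `i` and `i + 1`. -/
noncomputable def sphereToDisk (P : B) (i : ℤ) : sphere P (i + 1) ⟶ disk P i :=
  mkHomFromSingle (doubleXIso₁ (𝟙 P) _ (by lia)).inv
    (fun _ _ ↦ by rw [double_d_eq_zero₀ _ _ _ _ (by lia), comp_zero])

/-- A square from `sphereToDisk P i` to `g` is a cycle `z` of `E` together with an element `y` of
`F` bounding its image, on elements defined over `P`; a lift is an element of `E` that bounds `z`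
and lies over `y`. -/
lemma hasLiftingProperty_sphereToDisk_iff {P : B} {i : ℤ} {E F : CochainComplex B ℤ} (g : E ⟶ F) :
    HasLiftingProperty (sphereToDisk P i) g ↔
      ∀ (z : P ⟶ E.X (i + 1)) (y : P ⟶ F.X i), z ≫ E.d (i + 1) (i + 1 + 1) = 0 →
        y ≫ F.d i (i + 1) = z ≫ g.f (i + 1) →
        ∃ x : P ⟶ E.X i, x ≫ E.d i (i + 1) = z ∧ x ≫ g.f i = y := by
  have hi : i ≠ i + 1 := by lia
  constructor
  · intro _ z y hz hzy
    have sq : CommSq (mkHomFromSingle z (by rintro _ rfl; exact hz)) (sphereToDisk P i) g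
        (mkHomFromDouble _ hi y (y ≫ F.d i (i + 1)) (by simp) (by simp)) := ⟨by
      ext
      simp [sphereToDisk, hzy]⟩
    obtain ⟨⟨l, hl₁, hl₂⟩⟩ := (HasLiftingProperty.sq_hasLift sq).exists_lift
    have h₁ := congr_arg (fun φ ↦ Hom.f φ (i + 1)) hl₁
    have h₂ := congr_arg (fun φ ↦ Hom.f φ i) hl₂
    simp only [sphereToDisk, comp_f, mkHomFromSingle_f, mkHomFromDouble_f₀, Category.assoc,
      Iso.cancel_iso_hom_left] at h₁ h₂
    refine ⟨(doubleXIso₀ (𝟙 P) _).inv ≫ l.f i, ?_, ?_⟩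
    · rw [Category.assoc, Hom.comm, double_d _ _ hi]
      simpa using h₁
    · simp [h₂]
  · intro h
    refine ⟨fun {t b} sq ↦ ?_⟩
    have w := congr_arg (fun φ ↦ Hom.f φ (i + 1)) sq.w
    simp only [sphereToDisk, comp_f, mkHomFromSingle_f, Category.assoc] at w
    obtain ⟨x, hx₁, hx₂⟩ := h ((singleObjXSelf _ _ P).inv ≫ t.f (i + 1))
      ((doubleXIso₀ (𝟙 P) _).inv ≫ b.f i)
      (by rw [Category.assoc, Hom.comm]; simp)
      (by rw [Category.assoc, Hom.comm, double_d _ _ hi, Category.assoc _ _ (g.f _), w]; simp)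
    refine ⟨⟨{ l := mkHomFromDouble _ hi x (x ≫ E.d i (i + 1)) (by simp) (by simp)
               fac_left := ?_, fac_right := ?_ }⟩⟩
    · ext
      simp [sphereToDisk, hx₁]
    · ext
      · simp [hx₂]
      · simp [reassoc_of% hx₁, w]

lemma isCardinalPresentable_disk [HasColimitsOfSize.{v, v} B] (P : B) (κ : Cardinal.{v})
    [Fact κ.IsRegular] [IsCardinalPresentable P κ] (i : ℤ) : IsCardinalPresentable (disk P i) κ :=
  have : (eval B (ComplexShape.up ℤ) i).IsCardinalAccessible κ := { }
  Functor.isCardinalAccessible_of_natIso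
    (evalCompCoyonedaCorepresentableByDoubleId
      (show (ComplexShape.up ℤ).Rel i (i + 1) from rfl) (by lia) P).toIso.symm κ

/-- The sphere in degree `i` is the cokernel of a map from the disk in degrees `i + 1` and `i + 2`
to the disk in degrees `i` and `i + 1`; the disks corepresent `K ↦ (P ⟶ K.X i)`. -/
lemma isCardinalPresentable_sphere [HasColimitsOfSize.{v, v} B] (P : B) (κ : Cardinal.{v})
    [Fact κ.IsRegular] [IsCardinalPresentable P κ] (i : ℤ) : IsCardinalPresentable (sphere P i) κ := by
  have hi : i ≠ i + 1 := by lia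
  have hi' : i + 1 ≠ i + 1 + 1 := by lia
  let φ : disk P (i + 1) ⟶ disk P i :=
    mkHomFromDouble _ hi' (doubleXIso₁ (𝟙 P) _ hi).inv 0
      (by rw [double_d_eq_zero₀ _ _ _ _ hi.symm]; simp) (by simp)
  let π : disk P i ⟶ sphere P i :=
    mkHomFromDouble _ hi (singleObjXSelf (ComplexShape.up ℤ) i P).inv 0 (by simp) (by simp)
  have hπ : φ ≫ π = 0 := by
    ext <;> simp [φ, π]
  have hπ' : IsColimit (CokernelCofork.ofπ π hπ) := by
    have hd {K : CochainComplex B ℤ} (f : disk P i ⟶ K) (hf : φ ≫ f = 0) :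
        ((doubleXIso₀ (𝟙 P) _).inv ≫ f.f i) ≫ K.d i (i + 1) = 0 := by
      have := congr_arg (fun φ ↦ Hom.f φ (i + 1)) hf
      simp [φ] at this
      rw [Category.assoc, Hom.comm, double_d _ _ hi]
      simp [this]
    refine CokernelCofork.IsColimit.ofπ _ _
      (fun f hf ↦ mkHomFromSingle ((doubleXIso₀ (𝟙 P) _).inv ≫ f.f i)
        (by rintro _ rfl; exact hd f hf)) (fun f hf ↦ ?_) (fun f hf m hm ↦ ?_)
    · ext
      · simp [π]
      · have := congr_arg (fun φ ↦ Hom.f φ (i + 1)) hf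
        simp [φ] at this
        simp [π, this]
    · ext
      simp [← hm, π]
  have : ∀ k, IsCardinalPresentable ((parallelPair φ 0).obj k) κ := by
    rintro (_ | _) <;> exact isCardinalPresentable_disk ..
  exact isCardinalPresentable_of_isColimit _ hπ' κ
    (HasCardinalLT.of_le (hasCardinalLT_of_finite _ _ le_rfl)
      (Cardinal.IsRegular.aleph0_le Fact.out))

/-! ### The right lifting property with respect to the generating maps -/

/-- The class of all inclusions `sphereToDisk P i`, for `i : ℤ`. -/
def sphereToDisks (P : B) : MorphismProperty (CochainComplex B ℤ) :=
  .ofHoms (sphereToDisk P)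

lemma rlp_sphereToDisks_iff {P : B} {E F : CochainComplex B ℤ} (g : E ⟶ F) :
    (sphereToDisks P).rlp g ↔ ∀ (i : ℤ) (z : P ⟶ E.X (i + 1)) (y : P ⟶ F.X i),
        z ≫ E.d (i + 1) (i + 1 + 1) = 0 → y ≫ F.d i (i + 1) = z ≫ g.f (i + 1) →
        ∃ x : P ⟶ E.X i, x ≫ E.d i (i + 1) = z ∧ x ≫ g.f i = y := by
  simp only [← hasLiftingProperty_sphereToDisk_iff]
  refine ⟨fun h i ↦ h _ ⟨i⟩, fun h _ _ _ hf ↦ ?_⟩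
  obtain ⟨i⟩ := hf
  exact h i

lemma hasSmallObjectArgument_sphereToDisks [HasColimitsOfSize.{v, v} B] (P : B)
    [IsPresentable.{v} P] : (sphereToDisks P).HasSmallObjectArgument.{v} := by
  obtain ⟨κ, hκ, _⟩ := Functor.IsAccessible.exists_cardinal.{v} (F := coyoneda.obj (op P))
  have : Nonempty κ.ord.ToType := by simpa using hκ.out.ne_zero
  have := WellFoundedLT.toOrderBot κ.ord.ToType
  have : HasColimitsOfSize.{v, v} (CochainComplex B ℤ) := ⟨fun _ _ ↦ inferInstance⟩
  exact ⟨κ, inferInstance, inferInstance,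
    { isSmall := MorphismProperty.isSmall_ofHoms.{v} (sphereToDisk P)
      hasCoproducts := fun _ ↦ inferInstance
      preservesColimit := by
        rintro _ _ _ _ _ ⟨i⟩ _ _
        have := isCardinalPresentable_sphere P κ (i + 1)
        have := preservesColimitsOfShape_of_isCardinalPresentable (sphere P (i + 1)) κ
          κ.ord.ToType
        infer_instance }⟩

lemma quasiIso_of_rlp_sphereToDisks {P : B} [Projective P] (hP : IsSeparator P)
    {E F : CochainComplex B ℤ} (g : E ⟶ F) (hg : (sphereToDisks P).rlp g) : QuasiIso g := by
  rw [rlp_sphereToDisks_iff] at hg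
  rw [quasiIso_iff]
  intro j
  obtain ⟨i, rfl⟩ : ∃ i, i + 1 = j := ⟨j - 1, by lia⟩
  rw [quasiIsoAt_iff_isIso_homologyMap]
  have h₁ : Epi (cyclesMap g (i + 1)) := by
    refine ⟨fun a b hab ↦ hP.def _ _ fun p ↦ ?_⟩
    -- a cycle `p` of `F` lifts to a cycle of `E`: lift the pair consisting of `0` and `p`
    obtain ⟨x, hx, hx'⟩ := hg (i + 1) 0 (p ≫ F.iCycles (i + 1)) (by simp) (by simp)
    have : E.liftCycles x (i + 1 + 1) (by simp) hx ≫ cyclesMap g (i + 1) = p := by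
      simp [← cancel_mono (F.iCycles (i + 1)), hx']
    rw [← this, Category.assoc, Category.assoc, hab]
  have h₂ : Epi (homologyMap g (i + 1)) := by
    have := epi_comp (cyclesMap g (i + 1)) (F.homologyπ (i + 1))
    rw [← homologyπ_naturality] at this
    exact epi_of_epi (E.homologyπ (i + 1)) _
  have h₃ : Mono (homologyMap g (i + 1)) := by
    refine Preadditive.mono_of_cancel_zero _ fun {A} a ha ↦ hP.def _ _ fun p ↦ ?_
    let c := Projective.factorThru (p ≫ a) (E.homologyπ (i + 1))
    have hc : c ≫ E.homologyπ (i + 1) = p ≫ a := Projective.factorThru_comp _ _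
    have hF := ShortComplex.exact_of_g_is_cokernel
      (.mk _ _ (F.toCycles_comp_homologyπ i (i + 1))) (F.homologyIsCokernel i (i + 1) (by simp))
    have hc' : (c ≫ cyclesMap g (i + 1)) ≫ F.homologyπ (i + 1) = 0 := by
      rw [Category.assoc, ← homologyπ_naturality, reassoc_of% hc, ha, comp_zero]
    -- the image in `F` of the cycle `c` bounds `y`, so that `c` is itself a boundary
    -- by lifting `(c, y)`
    obtain ⟨y, hy⟩ : ∃ y, y ≫ F.toCycles i (i + 1) = c ≫ cyclesMap g (i + 1) :=
      ⟨_, hF.liftFromProjective_comp _ hc'⟩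
    obtain ⟨x, hx, -⟩ := hg i (c ≫ E.iCycles (i + 1)) y (by simp)
      (by simpa using congr($hy ≫ F.iCycles (i + 1)))
    have hx' : x ≫ E.toCycles i (i + 1) = c := by
      simp [← cancel_mono (E.iCycles (i + 1)), hx]
    rw [← hc, ← hx']
    simp
  exact isIso_of_mono_of_epi _

lemma rlp_sphereToDisks_of_acyclic {P : B} [Projective P] {E F : CochainComplex B ℤ} (g : E ⟶ F)
    [∀ n, Epi (g.f n)] (hE : E.Acyclic) (hF : F.Acyclic) : (sphereToDisks P).rlp g := by
  have lift {K : CochainComplex B ℤ} (hK : K.Acyclic) (i : ℤ) (z : P ⟶ K.X (i + 1))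
      (hz : z ≫ K.d (i + 1) (i + 1 + 1) = 0) : ∃ x, x ≫ K.d i (i + 1) = z :=
    ⟨_, ((K.exactAt_iff' i (i + 1) (i + 1 + 1) (by simp) (by simp)).1
      (hK (i + 1))).liftFromProjective_comp z hz⟩
  rw [rlp_sphereToDisks_iff]
  intro i z y hz hzy
  obtain ⟨i, rfl⟩ : ∃ j, j + 1 = i := ⟨i - 1, by lia⟩
  -- choose `x` bounding `z` by acyclicity of `E`, and correct it by the boundary of a lift of `t`,
  -- where `t` bounds the difference of `x ≫ g` and `y` in `F`
  obtain ⟨x, hx⟩ := lift hE _ z hz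
  obtain ⟨t, ht⟩ := lift hF i (x ≫ g.f _ - y) (by
    rw [Preadditive.sub_comp, Category.assoc, g.comm, reassoc_of% hx, hzy, sub_self])
  refine ⟨x - Projective.factorThru t (g.f i) ≫ E.d _ _, by simp [hx], ?_⟩
  have := Projective.factorThru_comp t (g.f i)
  rw [Preadditive.sub_comp, Category.assoc, ← g.comm, reassoc_of% this, ht, sub_sub_cancel]

/-! ### Complexes with the lifting property against epimorphisms of acyclic complexes -/

lemma acyclic_of_homotopy_id_zero {K : CochainComplex B ℤ} (h : Homotopy (𝟙 K) 0) :
    K.Acyclic := by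
  rw [← HomotopyCategory.quotient_obj_mem_subcategoryAcyclic_iff_acyclic]
  refine ObjectProperty.prop_of_isZero _ ((IsZero.iff_id_eq_zero _).2 ?_)
  rw [← CategoryTheory.Functor.map_id, HomotopyCategory.eq_of_homotopy _ _ h, Functor.map_zero]

/-- Morphisms from `L` to the cone of an identity `𝟙 S` correspond to cochains of degree `0` from
`L` to `S`, and thus, for `S` concentrated in degree `n`, to morphisms out of `L.X n`. -/
lemma projective_X_of_hasLiftingProperty {L : CochainComplex B ℤ}
    (hL : ∀ ⦃E F : CochainComplex B ℤ⦄ (g : E ⟶ F) [∀ n, Epi (g.f n)], E.Acyclic → F.Acyclic →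
      ∀ f : L ⟶ F, ∃ l, l ≫ g = f) (n : ℤ) : Projective (L.X n) := by
  refine ⟨fun {M N} f q _ ↦ ?_⟩
  let S (M : B) : CochainComplex B ℤ := (single B (ComplexShape.up ℤ) n).obj M
  let s : S M ⟶ S N := (single B (ComplexShape.up ℤ) n).map q
  have hs (m : ℤ) : Epi (s.f m) :=
    inferInstanceAs (Epi ((single B (ComplexShape.up ℤ) n ⋙ eval B _ m).map q))
  let g : mappingCone (𝟙 (S M)) ⟶ mappingCone (𝟙 (S N)) := mappingCone.map _ _ s s (by simp)
  have hg (m : ℤ) : Epi (g.f m) := by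
    refine ⟨fun a b hab ↦ mappingCone.ext_from _ (m + 1) m rfl ?_ ?_⟩
    · rw [← cancel_epi (s.f (m + 1))]
      simpa [g, mappingCone.map] using
        congr((mappingCone.inl (𝟙 (S M))).v (m + 1) m (by lia) ≫ $hab)
    · rw [← cancel_epi (s.f m)]
      simpa [g, mappingCone.map] using congr((mappingCone.inr (𝟙 (S M))).f m ≫ $hab)
  have hS (M : B) : (mappingCone (𝟙 (S M))).Acyclic :=
    acyclic_of_homotopy_id_zero (mappingCone.homotopyToZeroOfId (S M))
  let β : HomComplex.Cochain L (S N) 0 :=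
    .single (f ≫ (singleObjXSelf (ComplexShape.up ℤ) n N).inv) 0
  -- the component of `φ` in the other summand is forced to be `-δ β`
  let φ : L ⟶ mappingCone (𝟙 (S N)) :=
    mappingCone.lift _ (HomComplex.Cocycle.mk (-HomComplex.δ 0 1 β) 2 rfl (by
      rw [HomComplex.δ_neg, HomComplex.δ_δ, neg_zero])) β (by simp)
  obtain ⟨l, hl⟩ := hL g (hS M) (hS N) φ
  refine ⟨l.f n ≫ (mappingCone.snd _).v n n (add_zero n) ≫
    (singleObjXSelf (ComplexShape.up ℤ) n M).hom, ?_⟩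
  have hg' : g.f n ≫ (mappingCone.snd _).v n n (add_zero n) =
      (mappingCone.snd _).v n n (add_zero n) ≫ s.f n :=
    mappingCone.ext_from _ (n + 1) n rfl (by simp [g, mappingCone.map])
      (by simp [g, mappingCone.map])
  have h := congr(Hom.f $hl n ≫ (mappingCone.snd _).v n n (add_zero n) ≫
    (singleObjXSelf (ComplexShape.up ℤ) n N).hom)
  simp only [comp_f, Category.assoc, reassoc_of% hg'] at h
  simpa [φ, β, s, single_map_f_self] using h

/-- Any morphism from `L` to an acyclic complex `A` lifts to the cocone of `𝟙 A`, which is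
contractible. -/
lemma isKProjective_of_hasLiftingProperty {L : CochainComplex B ℤ}
    (hL : ∀ ⦃E F : CochainComplex B ℤ⦄ (g : E ⟶ F) [∀ n, Epi (g.f n)], E.Acyclic → F.Acyclic →
      ∀ f : L ⟶ F, ∃ l, l ≫ g = f) : L.IsKProjective := by
  refine ⟨fun {A} f hA ↦ ?_⟩
  have (n : ℤ) : Epi ((mappingCocone.fst (𝟙 A)).f n) :=
    (SplitEpi.mk _ (mappingCocone.inl_v_fst_f (𝟙 A) n)).epi
  have h : Homotopy (𝟙 (mappingCocone (𝟙 A))) 0 :=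
    (Homotopy.ofEq (CategoryTheory.Functor.map_id _ _).symm).trans
      (((mappingCone.homotopyToZeroOfId A).shift (-1)).trans
        (Homotopy.ofEq (Functor.map_zero _ _ _)))
  obtain ⟨l, rfl⟩ := hL (mappingCocone.fst (𝟙 A)) (acyclic_of_homotopy_id_zero h) hA f
  exact ⟨(Homotopy.ofEq (by simp)).trans
    (((h.compRight (mappingCocone.fst (𝟙 A))).compLeft l).trans (Homotopy.ofEq (by simp)))⟩

lemma exists_isKProjective_projective_quasiIso [HasColimitsOfSize.{v, v} B] {P : B}
    [IsPresentable.{v} P] [Projective P] (hP : IsSeparator P) (K : CochainComplex B ℤ) :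
    ∃ (L : CochainComplex B ℤ) (p : L ⟶ K),
      L.IsKProjective ∧ (∀ n, Projective (L.X n)) ∧ QuasiIso p := by
  have := hasSmallObjectArgument_sphereToDisks P
  let h := MorphismProperty.factorizationData (sphereToDisks P).rlp.llp (sphereToDisks P).rlp
    (0 : (0 : CochainComplex B ℤ) ⟶ K)
  have hL ⦃E F : CochainComplex B ℤ⦄ (g : E ⟶ F) [∀ n, Epi (g.f n)] (hE : E.Acyclic)
      (hF : F.Acyclic) (f : h.Z ⟶ F) : ∃ l, l ≫ g = f := by
    have := h.hi g (rlp_sphereToDisks_of_acyclic g hE hF)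
    have sq : CommSq 0 h.i g f := ⟨(isZero_zero _).eq_of_src _ _⟩
    exact ⟨sq.lift, sq.fac_right⟩
  exact ⟨h.Z, h.p, isKProjective_of_hasLiftingProperty hL,
    projective_X_of_hasLiftingProperty hL, quasiIso_of_rlp_sphereToDisks hP _ h.hp⟩

end CochainComplex

theorem mainTheorem2 (B : Type u) [Category.{v} B] [Abelian B] [IsLocallyPresentable.{v} B]
    (hB : ∃ P : B, Projective P ∧ IsSeparator P) [HasDerivedCategory.{w} B] :
    HomotopyCategory.HasEnoughHomotopyProjectivesOfProjectives.{w} B := by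
  obtain ⟨P, _, hP⟩ := hB
  obtain ⟨κ, _, _⟩ := IsLocallyPresentable.exists_cardinal.{v} B
  have hK (K : HomotopyCategory B (ComplexShape.up ℤ))
      (h : HomotopyCategory.homotopyProjectiveOfProjectives B K)
      (L : HomotopyCategory B (ComplexShape.up ℤ)) :
      Function.Bijective (DerivedCategory.Qh.map : (K ⟶ L) → _) :=
    h.1.map_bijective_of_isTriangulated _ _
  refine ⟨inferInstance, { faithful := ⟨?_⟩, full := ⟨?_⟩, essSurj := ⟨fun X ↦ ?_⟩ }⟩
  · intro K L f g hfg
    exact ObjectProperty.hom_ext _ ((hK _ K.property _).injective hfg)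
  · intro K L f
    obtain ⟨g, hg⟩ := (hK K.obj K.property L.obj).surjective f
    exact ⟨ObjectProperty.homMk g, hg⟩
  · obtain ⟨L, p, hL, hL', hp⟩ := CochainComplex.exists_isKProjective_projective_quasiIso hP
      (DerivedCategory.Q.objPreimage X)
    exact ⟨⟨(HomotopyCategory.quotient _ _).obj L, hL.leftOrthogonal, hL'⟩,
      ⟨(DerivedCategory.quotientCompQhIso B).app L ≪≫ asIso (DerivedCategory.Q.map p) ≪≫
        DerivedCategory.Q.objObjPreimageIso X⟩⟩
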